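/- Let $G$ be a finite, simple, connected graph with at least one edge, vertex set $V$ and edge set $\mathsf E$. Fix $\ell>0$ and an orientation of the edges, and identify each edge $e$ with $[0,\ell]$, the point $0$ being its tail and $\ell$ its head. For each edge $e$ let $q_e\in L^2(0,\ell)$ be real-valued. For $\lambda\in\mathbb C$ let $s_e(\lambda,\cdot)$, $c_e(\lambda,\cdot)\in H^2(0,\ell)$ be the solutions of $-y''+q_ey=\lambda y$ on $(0,\ell)$ with $s_e(0)=0$, $s_e'(0)=1$ and $c_e(0)=1$, $c_e'(0)=0$. Fix a vertex $v_0\in V$, to which a half-infinite edge (lead) with zero potential is attached. Write $y_e=A_es_e(\lambda,\cdot)+B_ec_e(\lambda,\cdot)$. The standard conditions at a vertex $v$ are the $\deg v-1$ continuity equations $y(h)-y(h_v)=0$, where $h$ runs over the edge ends at $v$ other than a fixed reference end $h_v$, together with the Kirchhoff equation $$\sum_{e:\,\mathrm{head}(e)=v}y_e'(\ell)-\sum_{e:\,\mathrm{tail}(e)=v}y_e'(0)=0 .$$ Let $\Phi_N(\lambda)$ be the matrix of the resulting system of $2|\mathsf E|$ linear equations for the $2|\mathsf E|$ unknowns $A_e,B_e$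 when standard conditions are imposed at all vertices, and let $\Phi_D(\lambda)$ be the matrix obtained by replacing the Kirchhoff equation at $v_0$ with the Dirichlet condition $y(h_{v_0})=0$, in the same row. Let $\phi_N=a\det\Phi_N$ and $\phi_D=b\det\Phi_D$ with real constants $a,b$ such that $ab>0$ (characteristic functions are determined only up to constant multiples; here the two are normalised compatibly). Let $$E(z)=\phi_N(z^2)+iz\,\phi_D(z^2),\qquad z\in\mathbb C,$$ be the Jost function as a function of $z=\sqrt\lambda$. Then $E$ is an entire function of $z$. Its zeros are located symmetrically, with multiplicities, with respect to the imaginary axis. They lie in the closed upper half-plane $\{\operatorname{Im} z\ge 0\}$, apart from those on a finite segment of the negative imaginary half-axis: there is $R>0$ such that every zero $z$ of $E$ satisfies $\operatorname{Im}z\ge0$ or $z\in\{-i\tau: 0<\tau\le R\}$. -/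

import Mathlib

open MeasureTheory

noncomputable section

namespace EquilateralGraph

/-- `y ∈ H²(0, ℓ)`, with first derivative `dy`, solves `-y'' + q y = lam y` almost everywhere on
`(0, ℓ)`. Membership in `H²` is expressed by `y'' = ddy ∈ L²(0, ℓ)`, with `dy` and `y` the
(continuous up to the boundary) successive primitives. -/
def IsSolution (ℓ : ℝ) (q : ℝ → ℝ) (lam : ℂ) (y dy : ℝ → ℂ) : Prop :=
  ∃ ddy : ℝ → ℂ,
    MemLp ddy 2 (volume.restrict (Set.Ioo 0 ℓ)) ∧
    (∀ x ∈ Set.Icc 0 ℓ, dy x = dy 0 + ∫ t in (0 : ℝ)..x, ddy t) ∧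
    (∀ x ∈ Set.Icc 0 ℓ, y x = y 0 + ∫ t in (0 : ℝ)..x, dy t) ∧
    (∀ᵐ x ∂(volume.restrict (Set.Ioo 0 ℓ)), -ddy x + (q x : ℂ) * y x = lam * y x)

/-- The solution `(y, y')` of `-y'' + q y = lam y` on `[0, ℓ]` with `y(0) = a`, `y'(0) = b`.
For `q ∈ L²(0, ℓ)` it exists and is unique on `[0, ℓ]`; only its values there are used. -/
def solution (ℓ : ℝ) (q : ℝ → ℝ) (lam a b : ℂ) : (ℝ → ℂ) × (ℝ → ℂ) :=
  Classical.epsilon fun p => IsSolution ℓ q lam p.1 p.2 ∧ p.1 0 = a ∧ p.2 0 = b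

/-- The solution with `s(0) = 0`, `s'(0) = 1`, paired with its derivative. -/
def sSol (ℓ : ℝ) (q : ℝ → ℝ) (lam : ℂ) : (ℝ → ℂ) × (ℝ → ℂ) := solution ℓ q lam 0 1

/-- The solution with `c(0) = 1`, `c'(0) = 0`, paired with its derivative. -/
def cSol (ℓ : ℝ) (q : ℝ → ℝ) (lam : ℂ) : (ℝ → ℂ) × (ℝ → ℂ) := solution ℓ q lam 1 0

variable {V : Type*}

/-- An orientation of the edges of a simple graph: each edge is identified with `[0, ℓ]`, the
point `0` corresponding to `tail e` and the point `ℓ` to `head e`. -/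
structure Orientation (G : SimpleGraph V) where
  tail : G.edgeSet → V
  head : G.edgeSet → V
  endpoints : ∀ e, s(tail e, head e) = (e : Sym2 V)

/-- The end points of edges: `(e, false)` is the initial end point (`x = 0`) of `e` and
`(e, true)` its terminal end point (`x = ℓ`). -/
abbrev EdgeEnd (G : SimpleGraph V) : Type _ := G.edgeSet × Bool

/-- The vertex at which an end of an edge lies. -/
def Orientation.vertex {G : SimpleGraph V} (o : Orientation G) (h : EdgeEnd G) : V :=
  bif h.2 then o.head h.1 else o.tail h.1

/-- The abscissa in `[0, ℓ]` of an end of an edge. -/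
def abscissa (ℓ : ℝ) : Bool → ℝ := fun b => bif b then ℓ else 0

section System

variable [Fintype V] [DecidableEq V] {G : SimpleGraph V} [DecidableRel G.Adj]
  (o : Orientation G) (ℓ : ℝ) (q : G.edgeSet → ℝ → ℝ) (lam : ℂ)

/-- The value at `x` of `y_e = A_e s_e + B_e c_e`, where `A_e = coef (e, false)` and
`B_e = coef (e, true)`. -/
def edgeFun (coef : G.edgeSet × Bool → ℂ) (e : G.edgeSet) (x : ℝ) : ℂ :=
  coef (e, false) * (sSol ℓ (q e) lam).1 x + coef (e, true) * (cSol ℓ (q e) lam).1 x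

/-- The value at `x` of `y_e' = A_e s_e' + B_e c_e'`. -/
def edgeDeriv (coef : G.edgeSet × Bool → ℂ) (e : G.edgeSet) (x : ℝ) : ℂ :=
  coef (e, false) * (sSol ℓ (q e) lam).2 x + coef (e, true) * (cSol ℓ (q e) lam).2 x

/-- The boundary value of `y` at an end of an edge. -/
def endValue (coef : G.edgeSet × Bool → ℂ) (h : EdgeEnd G) : ℂ :=
  edgeFun ℓ q lam coef h.1 (abscissa ℓ h.2)

/-- The Kirchhoff defect `∑_{head e = v} y_e'(ℓ) - ∑_{tail e = v} y_e'(0)` at `v`. -/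
def kirchhoff (coef : G.edgeSet × Bool → ℂ) (v : V) : ℂ :=
  (∑ e : G.edgeSet with o.head e = v, edgeDeriv ℓ q lam coef e ℓ)
    - ∑ e : G.edgeSet with o.tail e = v, edgeDeriv ℓ q lam coef e 0

/-- The left-hand sides of the `2E` linear equations on the coefficients of `y` which express the
standard conditions at the vertices outside `S` and the Dirichlet conditions at the vertices
in `S`. The equations at `v` are labelled by the `deg v` edge ends at `v`, among which
`ref v` is distinguished. An edge end `h ≠ ref v` at `v` carries the continuity condition
`y(h) - y(ref v) = 0`; the edge end `ref v` carries the Kirchhoff condition if `v ∉ S` and the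
condition `y(ref v) = 0` if `v ∈ S`. -/
def condition (ref : V → EdgeEnd G) (S : Finset V) (coef : G.edgeSet × Bool → ℂ)
    (h : EdgeEnd G) : ℂ :=
  if h = ref (o.vertex h) then
    if o.vertex h ∈ S then endValue ℓ q lam coef h
    else kirchhoff o ℓ q lam coef (o.vertex h)
  else endValue ℓ q lam coef h - endValue ℓ q lam coef (ref (o.vertex h))

/-- The `2E × 2E` matrix of this linear system. -/
def charMatrix (ref : V → EdgeEnd G) (S : Finset V) :
    Matrix (EdgeEnd G) (G.edgeSet × Bool) ℂ :=
  Matrix.of fun h j => condition o ℓ q lam ref S (Pi.single j 1) h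

/-- The characteristic function of the problem with Dirichlet conditions on `S` and standard
conditions elsewhere. -/
def charFun (ref : V → EdgeEnd G) (S : Finset V) (lam : ℂ) : ℂ :=
  (charMatrix o ℓ q lam ref S).det

/-- The characteristic function of the Neumann problem. -/
def phiN (ref : V → EdgeEnd G) (lam : ℂ) : ℂ := charFun o ℓ q ref ∅ lam

/-- The characteristic function of the problem with a Dirichlet condition at `v₀`. -/
def phiD (ref : V → EdgeEnd G) (v₀ : V) (lam : ℂ) : ℂ := charFun o ℓ q ref {v₀} lam

/-- The Jost function `E(√lam) = φ_N(lam) + i √lam φ_D(lam)`, as a function of `z = √lam`, for a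
lead with zero potential attached at `v₀`. The factors `a`, `b` account for the characteristic
functions being determined up to constant multiples only. -/
def jost (ref : V → EdgeEnd G) (v₀ : V) (a b : ℝ) (z : ℂ) : ℂ :=
  a * phiN o ℓ q ref (z ^ 2) + Complex.I * z * (b * phiD o ℓ q ref v₀ (z ^ 2))

end System

end EquilateralGraph

end

/-! Only the Kirchhoff row at `v₀` distinguishes the two matrices, and the determinant is linear in
that row. Hence `E(z)` is the determinant of one Robin-type system, with the condition `a K + i z b
y(v₀) = 0` at `v₀`, `K` being the Kirchhoff defect there (`jost_eq_det`). A zero of `E` yields a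
nontrivial function `y` on the graph. Green's identity on each edge, summed with the vertex
conditions (`sum_boundary_eq`), gives `a (D - z² N) = -i z b |y(v₀)|²`, where `D = ∑ ∫ |y'|² + q
|y|²` and `N = ∑ ∫ |y|² > 0`. For `Im z < 0` the imaginary part forces `Re z = 0`, by `a b > 0`. The
real part then forces `D + (Im z)² N ≤ 0`, while `D ≥ -S N` with `S` depending only on the
potentials (`exists_energyForm_bound`); this bounds `|Im z|`.

Entireness comes from a Volterra equation whose resolvent is holomorphic in `lam`. The symmetry
comes from the potentials being real: `E(-conj z) = conj (E z)`, an identity that also carries local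
factorisations, hence multiplicities, from `z` to `-conj z`. -/

noncomputable section

namespace EquilateralGraph

/-! ### Primitives of integrable functions and integration by parts. -/

/-- `f` is the primitive of the integrable function `g` on `[0, ℓ]`. -/
def IsPrimitiveOn (ℓ : ℝ) (f g : ℝ → ℂ) : Prop :=
  IntervalIntegrable g volume 0 ℓ ∧ ∀ x ∈ Set.Icc 0 ℓ, f x = f 0 + ∫ t in (0 : ℝ)..x, g t

theorem absolutelyContinuousOnInterval_integral {f : ℝ → ℂ} {a b : ℝ}
    (h : IntervalIntegrable f volume a b) :
    AbsolutelyContinuousOnInterval (fun x => ∫ t in a..x, f t) a b := by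
  have hc (z : ℂ) : AbsolutelyContinuousOnInterval (fun _ : ℝ => z) a b :=
    (LipschitzWith.const z).lipschitzOnWith.absolutelyContinuousOnInterval
  have hre : IntervalIntegrable (fun x => (f x).re) volume a b := ⟨h.1.re, h.2.re⟩
  have him : IntervalIntegrable (fun x => (f x).im) volume a b := ⟨h.1.im, h.2.im⟩
  have key := ((hre.absolutelyContinuousOnInterval_intervalIntegral
      (c := a) (by simp)).smul (hc 1)).add
    ((him.absolutelyContinuousOnInterval_intervalIntegral
      (c := a) (by simp)).smul (hc Complex.I))
  rw [absolutelyContinuousOnInterval_iff] at key ⊢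
  have heq : ∀ x ∈ Set.uIcc a b, (∫ t in a..x, f t) =
      ((fun x : ℝ => ∫ t in a..x, (f t).re) • (fun _ : ℝ => (1 : ℂ)) +
        (fun x : ℝ => ∫ t in a..x, (f t).im) • (fun _ : ℝ => Complex.I) : ℝ → ℂ) x := by
    intro x hx
    have hfx : IntervalIntegrable f volume a x :=
      h.mono_set (Set.uIcc_subset_uIcc_left hx)
    have h1 : (∫ t in a..x, (f t).re) = (∫ t in a..x, f t).re :=
      (Complex.reCLM.intervalIntegral_comp_comm hfx)
    have h2 : (∫ t in a..x, (f t).im) = (∫ t in a..x, f t).im :=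
      (Complex.imCLM.intervalIntegral_comp_comm hfx)
    simp [h1, h2, Complex.re_add_im]
  intro ε hε
  obtain ⟨δ, hδ, H⟩ := key ε hε
  refine ⟨δ, hδ, fun E hE hs => ?_⟩
  convert H E hE hs using 2 with i hi
  rw [heq _ (hE.1 i hi).1, heq _ (hE.1 i hi).2]

namespace IsPrimitiveOn

variable {ℓ : ℝ} {f f' g g' : ℝ → ℂ}

theorem absolutelyContinuousOnInterval (h : IsPrimitiveOn ℓ f f') :
    AbsolutelyContinuousOnInterval (fun x => f 0 + ∫ t in (0 : ℝ)..x, f' t) 0 ℓ :=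
  ((LipschitzWith.const (f 0)).lipschitzOnWith.absolutelyContinuousOnInterval).add
    (absolutelyContinuousOnInterval_integral h.1)

theorem continuousOn (hℓ : 0 ≤ ℓ) (h : IsPrimitiveOn ℓ f f') : ContinuousOn f (Set.Icc 0 ℓ) := by
  have := h.absolutelyContinuousOnInterval.continuousOn
  rw [Set.uIcc_of_le hℓ] at this
  exact this.congr h.2

theorem mono (h : IsPrimitiveOn ℓ f f') {x : ℝ} (hx : x ∈ Set.Icc 0 ℓ) : IsPrimitiveOn x f f' :=
  ⟨h.1.mono_set (Set.uIcc_subset_uIcc_left (by rwa [Set.uIcc_of_le (hx.1.trans hx.2)])),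
    fun t ht => h.2 t ⟨ht.1, ht.2.trans hx.2⟩⟩

theorem of_continuousOn_deriv (hℓ : 0 ≤ ℓ) (hf' : ContinuousOn f' (Set.Icc 0 ℓ))
    (h : ∀ x ∈ Set.Icc 0 ℓ, f x = f 0 + ∫ t in (0 : ℝ)..x, f' t) : IsPrimitiveOn ℓ f f' :=
  ⟨ContinuousOn.intervalIntegrable (by rwa [Set.uIcc_of_le hℓ]), h⟩

theorem integrable_mul (hℓ : 0 ≤ ℓ) (h : IsPrimitiveOn ℓ f f') (hg : ContinuousOn g (Set.Icc 0 ℓ)) :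
    IntervalIntegrable (fun x => f' x * g x) volume 0 ℓ :=
  h.1.mul_continuousOn (by rwa [Set.uIcc_of_le hℓ])

/-- The product minus the primitive of its formal derivative is absolutely continuous with
derivative zero almost everywhere, hence constant. This generality is needed because `y''` is merely
`L²`. -/
theorem integral_mul (hℓ : 0 ≤ ℓ) (h : IsPrimitiveOn ℓ f f') (hg : IsPrimitiveOn ℓ g g') :
    ∫ t in (0 : ℝ)..ℓ, (f' t * g t + f t * g' t) = f ℓ * g ℓ - f 0 * g 0 := by
  have hu : Set.uIcc 0 ℓ = Set.Icc 0 ℓ := Set.uIcc_of_le hℓ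
  have hint : IntervalIntegrable (fun t => f' t * g t + f t * g' t) volume 0 ℓ := by
    refine (h.integrable_mul hℓ (hg.continuousOn hℓ)).add ?_
    simpa only [mul_comm] using hg.integrable_mul hℓ (h.continuousOn hℓ)
  have hac := (h.absolutelyContinuousOnInterval.smul
    hg.absolutelyContinuousOnInterval).sub (absolutelyContinuousOnInterval_integral hint)
  obtain ⟨C, hC⟩ := hac.const_of_ae_hasDerivAt_zero (by
    filter_upwards [h.1.ae_hasDerivAt_integral, hg.1.ae_hasDerivAt_integral,
      hint.ae_hasDerivAt_integral] with x h1 h2 h3 hx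
    have d := (((h1 hx 0 (by simp)).const_add (f 0)).mul
      ((h2 hx 0 (by simp)).const_add (g 0))).sub (h3 hx 0 (by simp))
    convert! d using 1
    rw [← h.2 x (hu ▸ hx), ← hg.2 x (hu ▸ hx)]
    ring)
  have c0 := hC 0 (by simp)
  have c1 := hC ℓ (by simp)
  have e1 := h.2 ℓ (by simp [hℓ])
  have e2 := hg.2 ℓ (by simp [hℓ])
  simp only [Pi.sub_apply, smul_eq_mul, Pi.mul_apply] at c0 c1
  rw [← e1, ← e2, ← c0] at c1
  simp only [intervalIntegral.integral_same, add_zero, sub_zero] at c1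
  linear_combination -c1

theorem mul (hℓ : 0 ≤ ℓ) (h : IsPrimitiveOn ℓ f f') (hg : IsPrimitiveOn ℓ g g') :
    IsPrimitiveOn ℓ (fun x => f x * g x) (fun x => f' x * g x + f x * g' x) := by
  refine ⟨?_, fun x hx => ?_⟩
  · refine (h.integrable_mul hℓ (hg.continuousOn hℓ)).add ?_
    simpa only [mul_comm] using hg.integrable_mul hℓ (h.continuousOn hℓ)
  · rw [(h.mono hx).integral_mul hx.1 (hg.mono hx)]
    ring

theorem conj (h : IsPrimitiveOn ℓ f f') :
    IsPrimitiveOn ℓ (fun x => starRingEnd ℂ (f x)) (fun x => starRingEnd ℂ (f' x)) := by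
  refine ⟨⟨h.1.1.norm.mono' ?_ ?_, h.1.2.norm.mono' ?_ ?_⟩, fun x hx => ?_⟩
  · exact Complex.continuous_conj.comp_aestronglyMeasurable h.1.1.aestronglyMeasurable
  · simp
  · exact Complex.continuous_conj.comp_aestronglyMeasurable h.1.2.aestronglyMeasurable
  · simp
  · have : (∫ t in (0 : ℝ)..x, starRingEnd ℂ (f' t)) = starRingEnd ℂ (∫ t in (0 : ℝ)..x, f' t) := by
      rw [intervalIntegral.integral_of_le hx.1, intervalIntegral.integral_of_le hx.1, integral_conj]
    simp only [this]
    rw [h.2 x hx, map_add]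

theorem add (h : IsPrimitiveOn ℓ f f') (hg : IsPrimitiveOn ℓ g g') :
    IsPrimitiveOn ℓ (fun x => f x + g x) (fun x => f' x + g' x) := by
  refine ⟨h.1.add hg.1, fun x hx => ?_⟩
  simp only [intervalIntegral.integral_add (h.mono hx).1 (hg.mono hx).1, h.2 x hx, hg.2 x hx]
  ring

theorem const_mul (c : ℂ) (h : IsPrimitiveOn ℓ f f') :
    IsPrimitiveOn ℓ (fun x => c * f x) (fun x => c * f' x) := by
  refine ⟨h.1.const_mul c, fun x hx => ?_⟩
  simp only [intervalIntegral.integral_const_mul, h.2 x hx]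
  ring

end IsPrimitiveOn

/-! ### The initial value problem as a Volterra equation. -/

open scoped BoundedContinuousFunction

theorem intervalIntegrable_of_memLp {E : Type*} [NormedAddCommGroup E] {ℓ : ℝ} (hℓ : 0 ≤ ℓ)
    {f : ℝ → E} (hf : MemLp f 2 (volume.restrict (Set.Ioo 0 ℓ))) :
    IntervalIntegrable f volume 0 ℓ := by
  rw [intervalIntegrable_iff_integrableOn_Ioo_of_le hℓ]
  exact hf.integrable (by norm_num)

/-- The differential equation determines `ddy` almost everywhere, so it can be eliminated, leaving a
first-order integral system. Conversely `(q - lam) y` is in `L²`, since `q` is and `y` is bounded.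
-/
theorem isSolution_iff {ℓ : ℝ} (hℓ : 0 ≤ ℓ) {q : ℝ → ℝ}
    (hq : MemLp q 2 (volume.restrict (Set.Ioo 0 ℓ))) (lam : ℂ) (y dy : ℝ → ℂ) :
    IsSolution ℓ q lam y dy ↔
      IsPrimitiveOn ℓ y dy ∧ IsPrimitiveOn ℓ dy (fun x => ((q x : ℂ) - lam) * y x) := by
  constructor
  · rintro ⟨ddy, h2, h1, h0, hae⟩
    have hp : IsPrimitiveOn ℓ dy ddy := ⟨intervalIntegrable_of_memLp hℓ h2, h1⟩
    have hae' : ∀ᵐ x ∂(volume.restrict (Set.Ioc 0 ℓ)), ddy x = ((q x : ℂ) - lam) * y x := by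
      rw [← restrict_Ioo_eq_restrict_Ioc]
      filter_upwards [hae] with x hx
      linear_combination -hx
    refine ⟨.of_continuousOn_deriv hℓ (hp.continuousOn hℓ) h0, ?_, fun x hx => ?_⟩
    · exact hp.1.congr_ae (by rwa [Set.uIoc_of_le hℓ])
    · rw [hp.2 x hx]
      congr 1
      apply intervalIntegral.integral_congr_ae_restrict
      rw [Set.uIoc_of_le hx.1]
      exact ae_restrict_of_ae_restrict_of_subset (Set.Ioc_subset_Ioc_right hx.2) hae'
  · rintro ⟨h0, h1⟩
    refine ⟨fun x => ((q x : ℂ) - lam) * y x, ?_, h1.2, h0.2, .of_forall fun x => by ring⟩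
    obtain ⟨C, hC⟩ := isCompact_Icc.exists_bound_of_continuousOn (h0.continuousOn hℓ)
    have hy : MemLp y ⊤ (volume.restrict (Set.Ioo 0 ℓ)) := by
      refine memLp_top_of_bound (((h0.continuousOn hℓ).mono
        Set.Ioo_subset_Icc_self).aestronglyMeasurable measurableSet_Ioo) C ?_
      filter_upwards [ae_restrict_mem measurableSet_Ioo] with x hx
      exact hC x (Set.Ioo_subset_Icc_self hx)
    exact hy.mul (hq.ofReal.sub (memLp_const lam))

section Operators

variable {ℓ : ℝ} (hℓ : 0 ≤ ℓ)

/-- The bounded operator `f ↦ ∫₀ˣ w f` on functions on `[0, ℓ]`, these being extended by constants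
to the whole line. -/
def integralOp (w : ℝ → ℂ) (hw : IntervalIntegrable w volume 0 ℓ) : (ℝ →ᵇ ℂ) →L[ℂ] (ℝ →ᵇ ℂ) :=
  have hint (f : ℝ →ᵇ ℂ) : IntervalIntegrable (fun t => w t * f t) volume 0 ℓ :=
    hw.mul_continuousOn f.continuous.continuousOn
  have hsub (x : ℝ) : Set.uIcc 0 (Set.projIcc 0 ℓ hℓ x : ℝ) ⊆ Set.uIcc 0 ℓ :=
    Set.uIcc_subset_uIcc_left (by rw [Set.uIcc_of_le hℓ]; exact (Set.projIcc 0 ℓ hℓ x).2)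
  have hbd (f : ℝ →ᵇ ℂ) (x : ℝ) : ‖∫ t in (0 : ℝ)..(Set.projIcc 0 ℓ hℓ x), w t * f t‖ ≤
      (∫ t in (0 : ℝ)..ℓ, ‖w t‖) * ‖f‖ := by
    have hx := (Set.projIcc 0 ℓ hℓ x).2
    rw [← intervalIntegral.integral_mul_const]
    refine (intervalIntegral.norm_integral_le_integral_norm hx.1).trans ?_
    refine (intervalIntegral.integral_mono_interval le_rfl hx.1 hx.2
      (.of_forall fun t => norm_nonneg _) (hint f).norm).trans ?_
    refine intervalIntegral.integral_mono_on hℓ (hint f).norm (hw.norm.mul_const _) fun t _ => ?_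
    rw [norm_mul]
    gcongr
    exact f.norm_coe_le_norm t
  LinearMap.mkContinuous
    { toFun := fun f => BoundedContinuousFunction.ofNormedAddCommGroup
        (fun x => ∫ t in (0 : ℝ)..(Set.projIcc 0 ℓ hℓ x), w t * f t)
        (((intervalIntegral.continuousOn_primitive_interval'
          (hint f) (by simp)).comp_continuous
            (continuous_subtype_val.comp continuous_projIcc)
            (fun x => by rw [Set.uIcc_of_le hℓ]; exact (Set.projIcc 0 ℓ hℓ x).2)))
        _ (hbd f)
      map_add' := fun f g => by
        ext x
        simp only [BoundedContinuousFunction.coe_ofNormedAddCommGroup,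
          BoundedContinuousFunction.coe_add, Pi.add_apply, mul_add]
        exact intervalIntegral.integral_add ((hint f).mono_set (hsub x)) ((hint g).mono_set (hsub x))
      map_smul' := fun c f => by
        ext x
        simp only [BoundedContinuousFunction.coe_ofNormedAddCommGroup,
          BoundedContinuousFunction.coe_smul, smul_eq_mul, RingHom.id_apply,
          mul_left_comm _ c, intervalIntegral.integral_const_mul] }
    (∫ t in (0 : ℝ)..ℓ, ‖w t‖) fun f =>
      (BoundedContinuousFunction.norm_le (mul_nonneg
        (intervalIntegral.integral_nonneg hℓ fun t _ => norm_nonneg _) (norm_nonneg f))).2 (hbd f)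

theorem integralOp_apply (w : ℝ → ℂ) (hw : IntervalIntegrable w volume 0 ℓ) (f : ℝ →ᵇ ℂ) (x : ℝ) :
    integralOp hℓ w hw f x = ∫ t in (0 : ℝ)..(Set.projIcc 0 ℓ hℓ x), w t * f t := rfl

theorem integralOp_apply_of_mem (w : ℝ → ℂ) (hw : IntervalIntegrable w volume 0 ℓ) (f : ℝ →ᵇ ℂ)
    {x : ℝ} (hx : x ∈ Set.Icc 0 ℓ) : integralOp hℓ w hw f x = ∫ t in (0 : ℝ)..x, w t * f t := by
  rw [integralOp_apply, Set.projIcc_of_mem hℓ hx]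

theorem integralOp_apply_projIcc (w : ℝ → ℂ) (hw : IntervalIntegrable w volume 0 ℓ) (f : ℝ →ᵇ ℂ)
    (x : ℝ) : integralOp hℓ w hw f (Set.projIcc 0 ℓ hℓ x) = integralOp hℓ w hw f x := by
  rw [integralOp_apply, integralOp_apply, Set.projIcc_val]

/-- The operator `f ↦ ∫₀ˣ f`. -/
def primitiveOp : (ℝ →ᵇ ℂ) →L[ℂ] (ℝ →ᵇ ℂ) :=
  integralOp hℓ (fun _ => 1) intervalIntegrable_const

theorem primitiveOp_apply_of_mem (f : ℝ →ᵇ ℂ) {x : ℝ} (hx : x ∈ Set.Icc 0 ℓ) :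
    primitiveOp hℓ f x = ∫ t in (0 : ℝ)..x, f t := by
  simp [primitiveOp, integralOp_apply_of_mem hℓ _ _ _ hx]

/-- Each factor `integralOp` costs at most the `L¹` norm of `w`, and each outer primitive turns `tⁿ
/ n!` into `xⁿ⁺¹ / (n+1)!`. The factorial decay thus needs only integrability of `w`. -/
theorem norm_pow_primitiveOp_mul_integralOp_apply_le (w : ℝ → ℂ)
    (hw : IntervalIntegrable w volume 0 ℓ) (f : ℝ →ᵇ ℂ) (n : ℕ) {x : ℝ} (hx : x ∈ Set.Icc 0 ℓ) :
    ‖((primitiveOp hℓ * integralOp hℓ w hw) ^ n) f x‖ ≤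
      (∫ t in (0 : ℝ)..ℓ, ‖w t‖) ^ n * ‖f‖ * (x ^ n / n.factorial) := by
  set W := ∫ t in (0 : ℝ)..ℓ, ‖w t‖ with hW
  have hW0 : 0 ≤ W := intervalIntegral.integral_nonneg hℓ fun t _ => norm_nonneg _
  induction n generalizing x with
  | zero => simpa using f.norm_coe_le_norm x
  | succ n ih =>
    set g := ((primitiveOp hℓ * integralOp hℓ w hw) ^ n) f with hg
    have hstep (s : ℝ) (hs : s ∈ Set.Icc 0 ℓ) : ‖integralOp hℓ w hw g s‖ ≤
        W * (W ^ n * ‖f‖ * (s ^ n / n.factorial)) := by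
      have hint : IntervalIntegrable (fun t => w t * g t) volume 0 s :=
        (hw.mul_continuousOn g.continuous.continuousOn).mono_set
          (Set.uIcc_subset_uIcc_left (by rwa [Set.uIcc_of_le hℓ]))
      have hws : IntervalIntegrable w volume 0 s :=
        hw.mono_set (Set.uIcc_subset_uIcc_left (by rwa [Set.uIcc_of_le hℓ]))
      have hc : 0 ≤ W ^ n * ‖f‖ * (s ^ n / n.factorial) := by
        have := hs.1
        positivity
      rw [integralOp_apply_of_mem hℓ w hw g hs]
      refine (intervalIntegral.norm_integral_le_integral_norm hs.1).trans ?_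
      calc ∫ t in (0 : ℝ)..s, ‖w t * g t‖
          ≤ ∫ t in (0 : ℝ)..s, ‖w t‖ * (W ^ n * ‖f‖ * (s ^ n / n.factorial)) := by
            refine intervalIntegral.integral_mono_on hs.1 hint.norm (hws.norm.mul_const _)
              fun t ht => ?_
            rw [norm_mul]
            gcongr
            refine (ih ⟨ht.1, ht.2.trans hs.2⟩).trans ?_
            have := ht.1
            gcongr
            exact ht.2
        _ ≤ _ := by
            rw [intervalIntegral.integral_mul_const]
            gcongr
            exact intervalIntegral.integral_mono_interval le_rfl hs.1 hs.2
              (.of_forall fun t => norm_nonneg _) hw.norm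
    rw [pow_succ', mul_apply_eq_comp, ← hg, mul_apply_eq_comp,
      primitiveOp_apply_of_mem hℓ _ hx]
    refine (intervalIntegral.norm_integral_le_integral_norm hx.1).trans ?_
    calc ∫ t in (0 : ℝ)..x, ‖integralOp hℓ w hw g t‖
        ≤ ∫ t in (0 : ℝ)..x, W * (W ^ n * ‖f‖ * (t ^ n / n.factorial)) := by
          refine intervalIntegral.integral_mono_on hx.1
            (Continuous.intervalIntegrable (by fun_prop) _ _)
            (Continuous.intervalIntegrable (by fun_prop) _ _) fun t ht =>
              hstep t ⟨ht.1, ht.2.trans hx.2⟩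
      _ = _ := by
          simp only [intervalIntegral.integral_const_mul, intervalIntegral.integral_div,
            integral_pow]
          rw [Nat.factorial_succ]
          push_cast
          field_simp
          simp
          ring

/-- Some power `T ^ n` has norm below one, so `1 - T ^ n` is invertible; it is a product of two
commuting factors, one of which is `1 - T`. -/
theorem isUnit_one_sub_primitiveOp_mul_integralOp (w : ℝ → ℂ)
    (hw : IntervalIntegrable w volume 0 ℓ) :
    IsUnit (1 - primitiveOp hℓ * integralOp hℓ w hw) := by
  set T := primitiveOp hℓ * integralOp hℓ w hw with hT
  set W := ∫ t in (0 : ℝ)..ℓ, ‖w t‖ with hW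
  have hW0 : 0 ≤ W := intervalIntegral.integral_nonneg hℓ fun t _ => norm_nonneg _
  obtain ⟨n, hn, hn0⟩ := (((FloorSemiring.tendsto_pow_div_factorial_atTop
    (W * ℓ)).eventually_lt_const one_pos).and (Filter.eventually_gt_atTop 0)).exists
  have hTn : ‖T ^ n‖ < 1 := by
    refine lt_of_le_of_lt (ContinuousLinearMap.opNorm_le_bound _ (by positivity) fun f => ?_) hn
    refine (BoundedContinuousFunction.norm_le (by positivity)).2 fun x => ?_
    -- Positivity of the exponent matters: only after one application of `T` is the function
    -- constant outside `[0, ℓ]`, so that the bound there controls the whole norm.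
    obtain ⟨m, rfl⟩ := Nat.exists_eq_succ_of_ne_zero hn0.ne'
    have hx := (Set.projIcc 0 ℓ hℓ x).2
    have h1 : (T ^ (m + 1)) f x = (T ^ (m + 1)) f (Set.projIcc 0 ℓ hℓ x : ℝ) := by
      rw [pow_succ', mul_apply_eq_comp, hT, mul_apply_eq_comp]
      exact (integralOp_apply_projIcc hℓ _ _ _ x).symm
    rw [h1]
    refine (norm_pow_primitiveOp_mul_integralOp_apply_le hℓ w hw f (m + 1) hx).trans ?_
    rw [mul_pow, mul_div_assoc, mul_assoc, mul_assoc, mul_comm ‖f‖]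
    have := hx.1
    gcongr
    exact hx.2
  have hu : IsUnit (1 - T ^ n) :=
    isUnit_one_sub_of_norm_lt_one (R := (ℝ →ᵇ ℂ) →L[ℂ] (ℝ →ᵇ ℂ)) (x := T ^ n) hTn
  rw [← mul_neg_geom_sum] at hu
  have hcomm : Commute (1 - T) (∑ i ∈ Finset.range n, T ^ i) :=
    Commute.sum_right _ _ _ fun i _ => (Commute.one_left _).sub_left ((Commute.refl T).pow_right i)
  exact (hcomm.isUnit_mul_iff.1 hu).1

/-- The left side is visibly affine in `lam`, which gives holomorphy; the right side is a single
integral operator, to which the invertibility result applies. -/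
theorem integralOp_sub_smul_primitiveOp (w : ℝ → ℂ) (hw : IntervalIntegrable w volume 0 ℓ)
    (lam : ℂ) : integralOp hℓ w hw - lam • primitiveOp hℓ =
      integralOp hℓ (fun x => w x - lam) (hw.sub intervalIntegrable_const) := by
  ext f x
  have hsub : Set.uIcc 0 (Set.projIcc 0 ℓ hℓ x : ℝ) ⊆ Set.uIcc 0 ℓ :=
    Set.uIcc_subset_uIcc_left (by rw [Set.uIcc_of_le hℓ]; exact (Set.projIcc 0 ℓ hℓ x).2)
  have h1 : IntervalIntegrable (fun t => w t * f t) volume 0 (Set.projIcc 0 ℓ hℓ x) :=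
    (hw.mul_continuousOn f.continuous.continuousOn).mono_set hsub
  have h2 : IntervalIntegrable (fun t => lam * f t) volume 0 (Set.projIcc 0 ℓ hℓ x) :=
    Continuous.intervalIntegrable (by fun_prop) _ _
  simp only [sub_apply, smul_apply, primitiveOp,
    BoundedContinuousFunction.coe_sub, BoundedContinuousFunction.coe_smul, Pi.sub_apply,
    integralOp_apply, sub_mul, one_mul, smul_eq_mul]
  rw [intervalIntegral.integral_sub h1 h2, intervalIntegral.integral_const_mul]

end Operators

theorem intervalIntegrable_ofReal_of_memLp {ℓ : ℝ} (hℓ : 0 ≤ ℓ) {q : ℝ → ℝ}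
    (hq : MemLp q 2 (volume.restrict (Set.Ioo 0 ℓ))) :
    IntervalIntegrable (fun x => (q x : ℂ)) volume 0 ℓ :=
  intervalIntegrable_of_memLp hℓ hq.ofReal

/-- The operator `f ↦ ∫₀ˣ (q - lam) f`. -/
def potentialOp {ℓ : ℝ} (hℓ : 0 ≤ ℓ) {q : ℝ → ℝ}
    (hq : MemLp q 2 (volume.restrict (Set.Ioo 0 ℓ))) (lam : ℂ) : (ℝ →ᵇ ℂ) →L[ℂ] (ℝ →ᵇ ℂ) :=
  integralOp hℓ (fun x => (q x : ℂ)) (intervalIntegrable_ofReal_of_memLp hℓ hq) -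
    lam • primitiveOp hℓ

theorem potentialOp_apply_of_mem {ℓ : ℝ} (hℓ : 0 ≤ ℓ) {q : ℝ → ℝ}
    (hq : MemLp q 2 (volume.restrict (Set.Ioo 0 ℓ))) (lam : ℂ) (f : ℝ →ᵇ ℂ)
    {x : ℝ} (hx : x ∈ Set.Icc 0 ℓ) :
    potentialOp hℓ hq lam f x = ∫ t in (0 : ℝ)..x, ((q t : ℂ) - lam) * f t := by
  rw [potentialOp, integralOp_sub_smul_primitiveOp, integralOp_apply_of_mem hℓ _ _ _ hx]

theorem isUnit_one_sub_primitiveOp_mul_potentialOp {ℓ : ℝ} (hℓ : 0 ≤ ℓ) {q : ℝ → ℝ}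
    (hq : MemLp q 2 (volume.restrict (Set.Ioo 0 ℓ))) (lam : ℂ) :
    IsUnit (1 - primitiveOp hℓ * potentialOp hℓ hq lam) := by
  rw [potentialOp, integralOp_sub_smul_primitiveOp]
  exact isUnit_one_sub_primitiveOp_mul_integralOp hℓ _ _

/-- The solution of `-y'' + q y = lam y` with `y(0) = a`, `y'(0) = b`, extended by constants. -/
def flow {ℓ : ℝ} (hℓ : 0 ≤ ℓ) {q : ℝ → ℝ}
    (hq : MemLp q 2 (volume.restrict (Set.Ioo 0 ℓ))) (a b lam : ℂ) : ℝ →ᵇ ℂ :=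
  Ring.inverse (1 - primitiveOp hℓ * potentialOp hℓ hq lam)
    (.const ℝ a + primitiveOp hℓ (.const ℝ b))

/-- The derivative of `flow`. -/
def flowDeriv {ℓ : ℝ} (hℓ : 0 ≤ ℓ) {q : ℝ → ℝ}
    (hq : MemLp q 2 (volume.restrict (Set.Ioo 0 ℓ))) (a b lam : ℂ) : ℝ →ᵇ ℂ :=
  .const ℝ b + potentialOp hℓ hq lam (flow hℓ hq a b lam)

theorem differentiable_potentialOp {ℓ : ℝ} (hℓ : 0 ≤ ℓ) {q : ℝ → ℝ}
    (hq : MemLp q 2 (volume.restrict (Set.Ioo 0 ℓ))) : Differentiable ℂ (potentialOp hℓ hq) :=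
  (differentiable_id.smul_const (primitiveOp hℓ)).const_sub
    (integralOp hℓ (fun x => (q x : ℂ)) (intervalIntegrable_ofReal_of_memLp hℓ hq))

theorem differentiable_flow {ℓ : ℝ} (hℓ : 0 ≤ ℓ) {q : ℝ → ℝ}
    (hq : MemLp q 2 (volume.restrict (Set.Ioo 0 ℓ))) (a b : ℂ) :
    Differentiable ℂ (flow hℓ hq a b) := by
  intro lam
  have h := (differentiableAt_inverse (𝕜 := ℂ)
    (isUnit_one_sub_primitiveOp_mul_potentialOp hℓ hq lam)).comp lam
    (((differentiableAt_const (primitiveOp hℓ)).clm_comp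
      (differentiable_potentialOp hℓ hq lam)).const_sub 1)
  exact h.clm_apply (differentiableAt_const _)

theorem differentiable_flowDeriv {ℓ : ℝ} (hℓ : 0 ≤ ℓ) {q : ℝ → ℝ}
    (hq : MemLp q 2 (volume.restrict (Set.Ioo 0 ℓ))) (a b : ℂ) :
    Differentiable ℂ (flowDeriv hℓ hq a b) :=
  (differentiable_const _).add
    ((differentiable_potentialOp hℓ hq).clm_apply (differentiable_flow hℓ hq a b))

theorem flow_eq {ℓ : ℝ} (hℓ : 0 ≤ ℓ) {q : ℝ → ℝ}
    (hq : MemLp q 2 (volume.restrict (Set.Ioo 0 ℓ))) (a b lam : ℂ) :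
    flow hℓ hq a b lam = .const ℝ a + primitiveOp hℓ (flowDeriv hℓ hq a b lam) := by
  have h := Ring.mul_inverse_cancel _ (isUnit_one_sub_primitiveOp_mul_potentialOp hℓ hq lam)
  have h' := congrArg (fun S => S (BoundedContinuousFunction.const ℝ a +
    primitiveOp hℓ (.const ℝ b))) h
  simp only [mul_apply_eq_comp, sub_apply,
    one_apply_eq_self] at h'
  change flow hℓ hq a b lam - primitiveOp hℓ (potentialOp hℓ hq lam (flow hℓ hq a b lam)) = _ at h'
  rw [flowDeriv, map_add, ← add_assoc, ← h', sub_add_cancel]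

theorem flow_zero {ℓ : ℝ} (hℓ : 0 ≤ ℓ) {q : ℝ → ℝ}
    (hq : MemLp q 2 (volume.restrict (Set.Ioo 0 ℓ))) (a b lam : ℂ) : flow hℓ hq a b lam 0 = a := by
  rw [flow_eq, BoundedContinuousFunction.coe_add, Pi.add_apply,
    primitiveOp_apply_of_mem hℓ _ (by simp [hℓ])]
  simp

theorem flowDeriv_zero {ℓ : ℝ} (hℓ : 0 ≤ ℓ) {q : ℝ → ℝ}
    (hq : MemLp q 2 (volume.restrict (Set.Ioo 0 ℓ))) (a b lam : ℂ) :
    flowDeriv hℓ hq a b lam 0 = b := by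
  rw [flowDeriv, BoundedContinuousFunction.coe_add, Pi.add_apply,
    potentialOp_apply_of_mem hℓ hq _ _ (by simp [hℓ])]
  simp

theorem isSolution_flow {ℓ : ℝ} (hℓ : 0 ≤ ℓ) {q : ℝ → ℝ}
    (hq : MemLp q 2 (volume.restrict (Set.Ioo 0 ℓ))) (a b lam : ℂ) :
    IsSolution ℓ q lam (flow hℓ hq a b lam) (flowDeriv hℓ hq a b lam) := by
  rw [isSolution_iff hℓ hq]
  refine ⟨.of_continuousOn_deriv hℓ (flowDeriv hℓ hq a b lam).continuous.continuousOn
    fun x hx => ?_, ?_, fun x hx => ?_⟩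
  · rw [flow_zero]
    conv_lhs => rw [flow_eq]
    rw [BoundedContinuousFunction.coe_add, Pi.add_apply, primitiveOp_apply_of_mem hℓ _ hx]
    rfl
  · exact ((intervalIntegrable_ofReal_of_memLp hℓ hq).sub
      intervalIntegrable_const).mul_continuousOn (flow hℓ hq a b lam).continuous.continuousOn
  · rw [flowDeriv_zero]
    conv_lhs => rw [flowDeriv]
    rw [BoundedContinuousFunction.coe_add, Pi.add_apply, potentialOp_apply_of_mem hℓ hq _ _ hx]
    rfl

/-- Uniqueness: the constant extension `Y` of `y` solves the same Volterra equation as `flow`, whose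
operator is invertible. This pins down the values on `[0, ℓ]` of the arbitrarily chosen `solution`.
-/
theorem IsSolution.eqOn_flow {ℓ : ℝ} (hℓ : 0 ≤ ℓ) {q : ℝ → ℝ}
    (hq : MemLp q 2 (volume.restrict (Set.Ioo 0 ℓ))) {a b lam : ℂ} {y dy : ℝ → ℂ}
    (h : IsSolution ℓ q lam y dy)
    (ha : y 0 = a) (hb : dy 0 = b) :
    Set.EqOn y (flow hℓ hq a b lam) (Set.Icc 0 ℓ) ∧
      Set.EqOn dy (flowDeriv hℓ hq a b lam) (Set.Icc 0 ℓ) := by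
  obtain ⟨h0, h1⟩ := (isSolution_iff hℓ hq lam y dy).1 h
  obtain ⟨C, hC⟩ := isCompact_Icc.exists_bound_of_continuousOn (h0.continuousOn hℓ)
  let Y : ℝ →ᵇ ℂ := BoundedContinuousFunction.ofNormedAddCommGroup
    (fun x => y (Set.projIcc 0 ℓ hℓ x))
    ((h0.continuousOn hℓ).comp_continuous (continuous_subtype_val.comp continuous_projIcc)
      fun x => (Set.projIcc 0 ℓ hℓ x).2) C fun x => hC _ (Set.projIcc 0 ℓ hℓ x).2
  have hY (x : ℝ) (hx : x ∈ Set.Icc 0 ℓ) : Y x = y x := by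
    change y (Set.projIcc 0 ℓ hℓ x) = y x
    rw [Set.projIcc_of_mem hℓ hx]
  have hpot (x : ℝ) (hx : x ∈ Set.Icc 0 ℓ) : dy x = b + potentialOp hℓ hq lam Y x := by
    rw [potentialOp_apply_of_mem hℓ hq lam Y hx, h1.2 x hx, hb]
    congr 1
    refine intervalIntegral.integral_congr fun t ht => ?_
    rw [Set.uIcc_of_le hx.1] at ht
    simp only [hY t ⟨ht.1, ht.2.trans hx.2⟩]
  have hfix : (1 - primitiveOp hℓ * potentialOp hℓ hq lam) Y =
      .const ℝ a + primitiveOp hℓ (.const ℝ b) := by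
    ext x
    have hx := (Set.projIcc 0 ℓ hℓ x).2
    have e1 : Y x = a + ∫ t in (0 : ℝ)..(Set.projIcc 0 ℓ hℓ x), dy t := by
      rw [← ha]
      exact h0.2 _ hx
    have e2 : ∫ t in (0 : ℝ)..(Set.projIcc 0 ℓ hℓ x), dy t =
        primitiveOp hℓ (.const ℝ b + potentialOp hℓ hq lam Y) x := by
      rw [primitiveOp, ← integralOp_apply_projIcc, ← primitiveOp, primitiveOp_apply_of_mem hℓ _ hx]
      refine intervalIntegral.integral_congr fun t ht => ?_
      rw [Set.uIcc_of_le hx.1] at ht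
      exact hpot t ⟨ht.1, ht.2.trans hx.2⟩
    have e3 : Y x = a + primitiveOp hℓ (.const ℝ b) x +
        primitiveOp hℓ (potentialOp hℓ hq lam Y) x := by
      rw [e1, e2, map_add, BoundedContinuousFunction.coe_add, Pi.add_apply, add_assoc]
    change Y x - primitiveOp hℓ (potentialOp hℓ hq lam Y) x = a + primitiveOp hℓ (.const ℝ b) x
    rw [e3]
    ring
  have hYflow : Y = flow hℓ hq a b lam := by
    rw [flow, ← hfix, ← mul_apply_eq_comp,
      Ring.inverse_mul_cancel _ (isUnit_one_sub_primitiveOp_mul_potentialOp hℓ hq lam)]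
    rfl
  refine ⟨fun x hx => by rw [← hYflow, hY x hx], fun x hx => ?_⟩
  rw [hpot x hx, flowDeriv, hYflow]
  rfl

theorem isSolution_solution {ℓ : ℝ} (hℓ : 0 ≤ ℓ) {q : ℝ → ℝ}
    (hq : MemLp q 2 (volume.restrict (Set.Ioo 0 ℓ))) (lam a b : ℂ) :
    IsSolution ℓ q lam (solution ℓ q lam a b).1 (solution ℓ q lam a b).2 ∧
      (solution ℓ q lam a b).1 0 = a ∧ (solution ℓ q lam a b).2 0 = b :=
  Classical.epsilon_spec
    (p := fun p : (ℝ → ℂ) × (ℝ → ℂ) => IsSolution ℓ q lam p.1 p.2 ∧ p.1 0 = a ∧ p.2 0 = b)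
    ⟨(flow hℓ hq a b lam, flowDeriv hℓ hq a b lam), isSolution_flow hℓ hq a b lam,
      flow_zero hℓ hq a b lam, flowDeriv_zero hℓ hq a b lam⟩

theorem differentiable_solution {ℓ : ℝ} (hℓ : 0 ≤ ℓ) {q : ℝ → ℝ}
    (hq : MemLp q 2 (volume.restrict (Set.Ioo 0 ℓ))) (a b : ℂ) {x : ℝ} (hx : x ∈ Set.Icc 0 ℓ) :
    Differentiable ℂ (fun lam => (solution ℓ q lam a b).1 x) ∧
      Differentiable ℂ (fun lam => (solution ℓ q lam a b).2 x) := by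
  have heq (lam : ℂ) := (isSolution_solution hℓ hq lam a b).1.eqOn_flow hℓ hq
    (isSolution_solution hℓ hq lam a b).2.1 (isSolution_solution hℓ hq lam a b).2.2
  constructor
  · simp only [fun lam => (heq lam).1 hx]
    exact (BoundedContinuousFunction.evalCLM ℂ x).differentiable.comp (differentiable_flow hℓ hq a b)
  · simp only [fun lam => (heq lam).2 hx]
    exact (BoundedContinuousFunction.evalCLM ℂ x).differentiable.comp
      (differentiable_flowDeriv hℓ hq a b)

/-- As `q` is real, conjugating the equation replaces `lam` by its conjugate; uniqueness does the
rest. -/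
theorem solution_conj {ℓ : ℝ} (hℓ : 0 ≤ ℓ) {q : ℝ → ℝ}
    (hq : MemLp q 2 (volume.restrict (Set.Ioo 0 ℓ))) (lam a b : ℂ) {x : ℝ} (hx : x ∈ Set.Icc 0 ℓ) :
    (solution ℓ q (starRingEnd ℂ lam) (starRingEnd ℂ a) (starRingEnd ℂ b)).1 x =
        starRingEnd ℂ ((solution ℓ q lam a b).1 x) ∧
      (solution ℓ q (starRingEnd ℂ lam) (starRingEnd ℂ a) (starRingEnd ℂ b)).2 x =
        starRingEnd ℂ ((solution ℓ q lam a b).2 x) := by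
  have h1 := isSolution_solution hℓ hq lam a b
  have h2 := isSolution_solution hℓ hq (starRingEnd ℂ lam) (starRingEnd ℂ a) (starRingEnd ℂ b)
  have h3 := h2.1.eqOn_flow hℓ hq h2.2.1 h2.2.2
  have h4 : IsSolution ℓ q (starRingEnd ℂ lam)
      (fun x => starRingEnd ℂ ((solution ℓ q lam a b).1 x))
      (fun x => starRingEnd ℂ ((solution ℓ q lam a b).2 x)) := by
    obtain ⟨p0, p1⟩ := (isSolution_iff hℓ hq _ _ _).1 h1.1
    refine (isSolution_iff hℓ hq _ _ _).2 ⟨p0.conj, ?_⟩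
    simpa using p1.conj
  have h5 := h4.eqOn_flow hℓ hq (congrArg _ h1.2.1) (congrArg _ h1.2.2)
  exact ⟨(h3.1 hx).trans (h5.1 hx).symm, (h3.2 hx).trans (h5.2 hx).symm⟩

/-! ### Green's identity and the lower bound for the energy form. -/

/-- The quadratic form `∫₀^ℓ |y'|² + q |y|²`. -/
def energyForm (ℓ : ℝ) (q : ℝ → ℝ) (y dy : ℝ → ℂ) : ℝ :=
  ∫ t in (0 : ℝ)..ℓ, (‖dy t‖ ^ 2 + q t * ‖y t‖ ^ 2)

/-- The squared norm of `y` in `L²(0, ℓ)`. -/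
def normSqIntegral (ℓ : ℝ) (y : ℝ → ℂ) : ℝ := ∫ t in (0 : ℝ)..ℓ, ‖y t‖ ^ 2

theorem intervalIntegrable_normSq {ℓ : ℝ} (hℓ : 0 ≤ ℓ) {y : ℝ → ℂ}
    (hy : ContinuousOn y (Set.Icc 0 ℓ)) :
    IntervalIntegrable (fun t => ‖y t‖ ^ 2) volume 0 ℓ :=
  ContinuousOn.intervalIntegrable (by rw [Set.uIcc_of_le hℓ]; exact hy.norm.pow 2)

theorem intervalIntegrable_mul_normSq {ℓ : ℝ} (hℓ : 0 ≤ ℓ) {q : ℝ → ℝ}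
    (hq : IntervalIntegrable q volume 0 ℓ) {y : ℝ → ℂ} (hy : ContinuousOn y (Set.Icc 0 ℓ)) :
    IntervalIntegrable (fun t => q t * ‖y t‖ ^ 2) volume 0 ℓ :=
  hq.mul_continuousOn (by rw [Set.uIcc_of_le hℓ]; exact hy.norm.pow 2)

theorem energyForm_sub_mul_normSqIntegral {ℓ : ℝ} (hℓ : 0 ≤ ℓ) {q : ℝ → ℝ}
    (hq : MemLp q 2 (volume.restrict (Set.Ioo 0 ℓ))) {lam : ℂ} {y dy : ℝ → ℂ}
    (h : IsSolution ℓ q lam y dy) :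
    (energyForm ℓ q y dy : ℂ) - lam * normSqIntegral ℓ y =
      dy ℓ * starRingEnd ℂ (y ℓ) - dy 0 * starRingEnd ℂ (y 0) := by
  obtain ⟨h0, h1⟩ := (isSolution_iff hℓ hq lam y dy).1 h
  have hq' := intervalIntegrable_of_memLp hℓ hq
  have hy := h0.continuousOn hℓ
  have hdy := h1.continuousOn hℓ
  have i1 : IntervalIntegrable (fun t => ‖dy t‖ ^ 2 + q t * ‖y t‖ ^ 2) volume 0 ℓ :=
    (intervalIntegrable_normSq hℓ hdy).add (intervalIntegrable_mul_normSq hℓ hq' hy)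
  rw [← h1.integral_mul hℓ h0.conj, energyForm, normSqIntegral, ← intervalIntegral.integral_ofReal,
    ← intervalIntegral.integral_ofReal, ← intervalIntegral.integral_const_mul,
    ← intervalIntegral.integral_sub]
  · refine intervalIntegral.integral_congr fun t _ => ?_
    have e1 := Complex.mul_conj' (y t)
    have e2 := Complex.mul_conj' (dy t)
    push_cast
    linear_combination -e2 - (q t - lam) * e1
  · exact ⟨i1.1.ofReal, i1.2.ofReal⟩
  · have i2 := intervalIntegrable_normSq hℓ hy
    exact IntervalIntegrable.const_mul ⟨i2.1.ofReal, i2.2.ofReal⟩ lam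

theorem normSqIntegral_nonneg {ℓ : ℝ} (hℓ : 0 ≤ ℓ) (y : ℝ → ℂ) : 0 ≤ normSqIntegral ℓ y :=
  intervalIntegral.integral_nonneg hℓ fun t _ => by positivity

theorem eqOn_zero_of_normSqIntegral_eq_zero {ℓ : ℝ} (hℓ : 0 < ℓ) {y : ℝ → ℂ}
    (hy : ContinuousOn y (Set.Icc 0 ℓ)) (h : normSqIntegral ℓ y = 0) :
    ∀ x ∈ Set.Icc 0 ℓ, y x = 0 := by
  by_contra! hne
  obtain ⟨x, hx, hyx⟩ := hne
  exact (intervalIntegral.integral_pos hℓ (hy.norm.pow 2) (fun t _ => sq_nonneg ‖y t‖)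
    ⟨x, hx, pow_pos (norm_pos_iff.2 hyx) 2⟩).ne' h

/-- If the norm vanished, `y` would vanish on `[0, ℓ]`, and Green's identity would reduce to `∫
|y'|² = 0`, contradicting the nonzero initial data. -/
theorem normSqIntegral_pos {ℓ : ℝ} (hℓ : 0 < ℓ) {q : ℝ → ℝ}
    (hq : MemLp q 2 (volume.restrict (Set.Ioo 0 ℓ))) {lam : ℂ} {y dy : ℝ → ℂ}
    (h : IsSolution ℓ q lam y dy) (hne : y 0 ≠ 0 ∨ dy 0 ≠ 0) : 0 < normSqIntegral ℓ y := by
  obtain ⟨h0, h1⟩ := (isSolution_iff hℓ.le hq lam y dy).1 h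
  refine (normSqIntegral_nonneg hℓ.le y).lt_of_ne' fun hz => ?_
  have hy := eqOn_zero_of_normSqIntegral_eq_zero hℓ (h0.continuousOn hℓ.le) hz
  have hen := energyForm_sub_mul_normSqIntegral hℓ.le hq h
  have h00 := hy 0 (by simp [hℓ.le])
  have hform : energyForm ℓ q y dy = normSqIntegral ℓ dy := by
    refine intervalIntegral.integral_congr fun t ht => ?_
    rw [Set.uIcc_of_le hℓ.le] at ht
    simp [hy t ht]
  rw [hz, hy ℓ (by simp [hℓ.le]), h00, hform] at hen
  have hdz : normSqIntegral ℓ dy = 0 := by simpa using hen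
  have := eqOn_zero_of_normSqIntegral_eq_zero hℓ (h1.continuousOn hℓ.le) hdz 0 (by simp [hℓ.le])
  tauto

/-- The variation of `|y|²` between two points is at most `∫ 2 |y| |y'|`, split by weighted AM-GM.
Averaging over the second point `t` produces the term with `ℓ⁻¹`. -/
theorem IsPrimitiveOn.normSq_le {ℓ : ℝ} (hℓ : 0 < ℓ) {y dy : ℝ → ℂ} (h : IsPrimitiveOn ℓ y dy)
    (hdy : ContinuousOn dy (Set.Icc 0 ℓ)) {ε : ℝ} (hε : 0 < ε) {x : ℝ} (hx : x ∈ Set.Icc 0 ℓ) :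
    ‖y x‖ ^ 2 ≤ ε * normSqIntegral ℓ dy + (ε⁻¹ + ℓ⁻¹) * normSqIntegral ℓ y := by
  have hy := h.continuousOn hℓ.le
  have i1 := intervalIntegrable_normSq hℓ.le hy
  have i2 := intervalIntegrable_normSq hℓ.le hdy
  have hp := h.mul hℓ.le h.conj
  have hpt (t : ℝ) (ht : t ∈ Set.Icc 0 ℓ) :
      ‖y x‖ ^ 2 ≤ ‖y t‖ ^ 2 + (ε * normSqIntegral ℓ dy + ε⁻¹ * normSqIntegral ℓ y) := by
    have hsub : Set.uIoc t x ⊆ Set.uIoc 0 ℓ := by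
      rw [Set.uIoc_of_le hℓ.le]
      exact Set.Ioc_subset_Ioc (le_min ht.1 hx.1) (max_le ht.2 hx.2)
    have hdiff : ((‖y x‖ ^ 2 - ‖y t‖ ^ 2 : ℝ) : ℂ) =
        ∫ s in t..x, (dy s * starRingEnd ℂ (y s) + y s * starRingEnd ℂ (dy s)) := by
      rw [← intervalIntegral.integral_interval_sub_left (hp.mono hx).1 (hp.mono ht).1]
      have e1 := hp.2 x hx
      have e2 := hp.2 t ht
      simp only [Complex.mul_conj'] at e1 e2
      push_cast
      linear_combination e1 - e2
    have hle : ‖y x‖ ^ 2 - ‖y t‖ ^ 2 ≤ ∫ s in (0 : ℝ)..ℓ, (ε * ‖dy s‖ ^ 2 + ε⁻¹ * ‖y s‖ ^ 2) := by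
      calc ‖y x‖ ^ 2 - ‖y t‖ ^ 2 ≤ ‖((‖y x‖ ^ 2 - ‖y t‖ ^ 2 : ℝ) : ℂ)‖ := by
            rw [Complex.norm_real]
            exact le_abs_self _
        _ ≤ ∫ s in Set.uIoc t x, ‖dy s * starRingEnd ℂ (y s) + y s * starRingEnd ℂ (dy s)‖ := by
            rw [hdiff]
            exact intervalIntegral.norm_integral_le_integral_norm_uIoc
        _ ≤ ∫ s in Set.uIoc 0 ℓ, ‖dy s * starRingEnd ℂ (y s) + y s * starRingEnd ℂ (dy s)‖ :=
            setIntegral_mono_set hp.1.norm.def' (.of_forall fun _ => norm_nonneg _)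
              hsub.eventuallyLE
        _ = ∫ s in (0 : ℝ)..ℓ, ‖dy s * starRingEnd ℂ (y s) + y s * starRingEnd ℂ (dy s)‖ := by
            rw [Set.uIoc_of_le hℓ.le, intervalIntegral.integral_of_le hℓ.le]
        _ ≤ _ := by
            refine intervalIntegral.integral_mono_on hℓ.le hp.1.norm
              ((i2.const_mul ε).add (i1.const_mul ε⁻¹)) fun s _ => ?_
            refine (norm_add_le _ _).trans ?_
            simp only [norm_mul, RCLike.norm_conj]
            have hsq : 0 ≤ ε⁻¹ * (ε * ‖dy s‖ - ‖y s‖) ^ 2 := by positivity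
            have hexp : ε⁻¹ * (ε * ‖dy s‖ - ‖y s‖) ^ 2 =
                ε * ‖dy s‖ ^ 2 + ε⁻¹ * ‖y s‖ ^ 2 - 2 * (‖dy s‖ * ‖y s‖) := by
              field_simp
              ring
            linarith
    rw [intervalIntegral.integral_add (i2.const_mul ε) (i1.const_mul ε⁻¹),
      intervalIntegral.integral_const_mul, intervalIntegral.integral_const_mul] at hle
    rw [normSqIntegral, normSqIntegral]
    linarith
  have hint := intervalIntegral.integral_mono_on hℓ.le intervalIntegrable_const
    (i1.add intervalIntegrable_const) hpt
  rw [intervalIntegral.integral_add i1 intervalIntegrable_const, intervalIntegral.integral_const,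
    intervalIntegral.integral_const, ← normSqIntegral, sub_zero, smul_eq_mul, smul_eq_mul] at hint
  have hmul := mul_le_mul_of_nonneg_left hint (inv_nonneg.2 hℓ.le)
  rw [inv_mul_cancel_left₀ hℓ.ne', mul_add, inv_mul_cancel_left₀ hℓ.ne'] at hmul
  linarith

/-- The potential term is at most `‖q‖₁ sup |y|²`. Taking `ε = (N + 1)⁻¹` in `normSq_le` makes `N ε
≤ 1`, so `∫ |y'|²` absorbs the derivative part; `N + 1` keeps `ε` defined when `N = 0`. -/
theorem exists_energyForm_bound {ℓ : ℝ} (hℓ : 0 < ℓ) {q : ℝ → ℝ}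
    (hq : IntervalIntegrable q volume 0 ℓ) :
    ∃ C : ℝ, 0 ≤ C ∧ ∀ y dy : ℝ → ℂ, IsPrimitiveOn ℓ y dy → ContinuousOn dy (Set.Icc 0 ℓ) →
      0 ≤ energyForm ℓ q y dy + C * normSqIntegral ℓ y := by
  set N := ∫ t in (0 : ℝ)..ℓ, |q t| with hN
  have hN0 : 0 ≤ N := intervalIntegral.integral_nonneg hℓ.le fun t _ => abs_nonneg _
  refine ⟨N * ((N + 1) + ℓ⁻¹), by positivity, fun y dy h hdy => ?_⟩
  have hy := h.continuousOn hℓ.le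
  set D := normSqIntegral ℓ dy with hD
  set Y := normSqIntegral ℓ y with hY
  have hD0 : 0 ≤ D := normSqIntegral_nonneg hℓ.le dy
  have hlow : -(N * ((N + 1)⁻¹ * D + (N + 1 + ℓ⁻¹) * Y)) ≤
      ∫ t in (0 : ℝ)..ℓ, q t * ‖y t‖ ^ 2 := by
    rw [hN, ← intervalIntegral.integral_mul_const, ← intervalIntegral.integral_neg]
    refine intervalIntegral.integral_mono_on hℓ.le (hq.abs.mul_const _).neg
      (intervalIntegrable_mul_normSq hℓ.le hq hy) fun t ht => ?_
    have hb := h.normSq_le hℓ hdy (ε := (N + 1)⁻¹) (by positivity) ht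
    rw [inv_inv] at hb
    have h1 : |q t| * ‖y t‖ ^ 2 ≤ |q t| * ((N + 1)⁻¹ * D + (N + 1 + ℓ⁻¹) * Y) :=
      mul_le_mul_of_nonneg_left hb (abs_nonneg _)
    have h2 : -|q t| * ‖y t‖ ^ 2 ≤ q t * ‖y t‖ ^ 2 :=
      mul_le_mul_of_nonneg_right (neg_abs_le _) (by positivity)
    linarith
  have hsplit : energyForm ℓ q y dy = D + ∫ t in (0 : ℝ)..ℓ, q t * ‖y t‖ ^ 2 :=
    intervalIntegral.integral_add (intervalIntegrable_normSq hℓ.le hdy)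
      (intervalIntegrable_mul_normSq hℓ.le hq hy)
  have hfrac : N * (N + 1)⁻¹ * D ≤ D := by
    refine mul_le_of_le_one_left hD0 ?_
    rw [← div_eq_mul_inv, div_le_one (by positivity)]
    linarith
  rw [hsplit]
  linarith

/-! ### Multiplicities under reflection in the imaginary axis. -/

theorem analyticOrderAt_neg_conj_eq {f : ℂ → ℂ} (hf : Differentiable ℂ f)
    (hsymm : ∀ w, f (-(starRingEnd ℂ w)) = starRingEnd ℂ (f w)) (z : ℂ) :
    analyticOrderAt f (-(starRingEnd ℂ z)) = analyticOrderAt f z := by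
  have hinv (w : ℂ) : -(starRingEnd ℂ (-(starRingEnd ℂ w))) = w := by simp
  have hcont : Continuous fun w : ℂ => -(starRingEnd ℂ w) := Complex.continuous_conj.neg
  have htend (z : ℂ) : Filter.Tendsto (fun w : ℂ => -(starRingEnd ℂ w))
      (nhds (-(starRingEnd ℂ z))) (nhds z) := by
    simpa using hcont.tendsto (-(starRingEnd ℂ z))
  have key (z : ℂ) (n : ℕ) (h : analyticOrderAt f z = n) :
      analyticOrderAt f (-(starRingEnd ℂ z)) = n := by
    obtain ⟨g, hg, hg0, hfg⟩ := (hf.analyticAt z).analyticOrderAt_eq_natCast.1 h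
    refine (hf.analyticAt _).analyticOrderAt_eq_natCast.2
      -- Conjugating `(-conj w - z) ^ n` gives `(-1) ^ n (w + conj z) ^ n`, whence the sign; a
      -- double conjugation keeps the cofactor holomorphic.
      ⟨fun w => (-1) ^ n * starRingEnd ℂ (g (-(starRingEnd ℂ w))), ?_, ?_, ?_⟩
    · rw [Complex.analyticAt_iff_eventually_differentiableAt]
      have hd := (Complex.analyticAt_iff_eventually_differentiableAt.1 hg)
      filter_upwards [(htend z).eventually hd] with w hw
      have h1 : DifferentiableAt ℂ (fun u => g (-u)) (starRingEnd ℂ w) :=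
        DifferentiableAt.comp (starRingEnd ℂ w) hw differentiableAt_id.neg
      have h2 := h1.conj_conj
      rw [Complex.conj_conj] at h2
      exact h2.const_mul _
    · simpa using hg0
    · filter_upwards [(htend z).eventually hfg] with w hw
      rw [← hinv w, hsymm, hw, hinv]
      simp only [smul_eq_mul, map_mul, map_pow, map_sub, map_neg, Complex.conj_conj]
      rw [← mul_assoc, ← mul_pow]
      congr 2
      ring
  rcases hn : analyticOrderAt f z with _ | n
  -- A finite order at the reflected point would, by the involution, give a finite order at `z`.
  · refine ENat.eq_top_iff_forall_ne.2 fun m hm => ?_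
    have := key _ m hm.symm
    rw [hinv, hn] at this
    exact ENat.top_ne_natCast m this
  · exact key z n hn

/-! ### Functions on the edges, the linear system and its determinant. -/

variable {V : Type*}

section Edge

variable {G : SimpleGraph V} {ℓ : ℝ} {q : G.edgeSet → ℝ → ℝ} {lam : ℂ}

theorem endValue_linear (c : ℂ) (f g : G.edgeSet × Bool → ℂ) (h : EdgeEnd G) :
    endValue ℓ q lam (c • f + g) h = c * endValue ℓ q lam f h + endValue ℓ q lam g h := by
  simp only [endValue, edgeFun, Pi.add_apply, Pi.smul_apply, smul_eq_mul]
  ring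

theorem isSolution_edgeFun (hℓ : 0 < ℓ)
    (hq : ∀ e, MemLp (q e) 2 (volume.restrict (Set.Ioo 0 ℓ)))
    (coef : G.edgeSet × Bool → ℂ) (e : G.edgeSet) :
    IsSolution ℓ (q e) lam (edgeFun ℓ q lam coef e) (edgeDeriv ℓ q lam coef e) ∧
      edgeFun ℓ q lam coef e 0 = coef (e, true) ∧ edgeDeriv ℓ q lam coef e 0 = coef (e, false) := by
  obtain ⟨s, s0, s1⟩ := isSolution_solution hℓ.le (hq e) lam 0 1
  obtain ⟨c, c0, c1⟩ := isSolution_solution hℓ.le (hq e) lam 1 0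
  refine ⟨?_, by simp [edgeFun, sSol, cSol, s0, c0], by simp [edgeDeriv, sSol, cSol, s1, c1]⟩
  rw [isSolution_iff hℓ.le (hq e)] at s c ⊢
  refine ⟨(s.1.const_mul _).add (c.1.const_mul _), ?_⟩
  convert! (s.2.const_mul (coef (e, false))).add (c.2.const_mul (coef (e, true))) using 1
  ext x
  simp only [edgeFun, sSol, cSol]
  ring

theorem abscissa_mem_Icc (hℓ : 0 < ℓ) (s : Bool) : abscissa ℓ s ∈ Set.Icc 0 ℓ := by
  cases s <;> simp [abscissa, hℓ.le]

theorem edge_conj (hℓ : 0 < ℓ) (hq : ∀ e, MemLp (q e) 2 (volume.restrict (Set.Ioo 0 ℓ)))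
    (coef : G.edgeSet × Bool → ℂ) (e : G.edgeSet) {x : ℝ} (hx : x ∈ Set.Icc 0 ℓ) :
    edgeFun ℓ q (starRingEnd ℂ lam) (fun j => starRingEnd ℂ (coef j)) e x =
        starRingEnd ℂ (edgeFun ℓ q lam coef e x) ∧
      edgeDeriv ℓ q (starRingEnd ℂ lam) (fun j => starRingEnd ℂ (coef j)) e x =
        starRingEnd ℂ (edgeDeriv ℓ q lam coef e x) := by
  have hs := solution_conj hℓ.le (hq e) lam 0 1 hx
  have hc := solution_conj hℓ.le (hq e) lam 1 0 hx
  simp only [map_zero, map_one] at hs hc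
  simp only [edgeFun, edgeDeriv, sSol, cSol, map_add, map_mul, hs, hc, and_self]

end Edge

section System

variable [Fintype V] [DecidableEq V] {G : SimpleGraph V} [DecidableRel G.Adj]
  (o : Orientation G) (ℓ : ℝ) (q : G.edgeSet → ℝ → ℝ) (lam : ℂ)

theorem kirchhoff_linear (c : ℂ) (f g : G.edgeSet × Bool → ℂ) (v : V) :
    kirchhoff o ℓ q lam (c • f + g) v = c * kirchhoff o ℓ q lam f v + kirchhoff o ℓ q lam g v := by
  have h (e : G.edgeSet) (x : ℝ) : edgeDeriv ℓ q lam (c • f + g) e x =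
      c * edgeDeriv ℓ q lam f e x + edgeDeriv ℓ q lam g e x := by
    simp only [edgeDeriv, Pi.add_apply, Pi.smul_apply, smul_eq_mul]
    ring
  simp only [kirchhoff, h, Finset.sum_add_distrib, ← Finset.mul_sum]
  ring

theorem isLinearMap_condition (ref : V → EdgeEnd G) (S : Finset V) (h : EdgeEnd G) :
    IsLinearMap ℂ fun coef => condition o ℓ q lam ref S coef h := by
  have hlin (c : ℂ) (f g : G.edgeSet × Bool → ℂ) : condition o ℓ q lam ref S (c • f + g) h =
      c * condition o ℓ q lam ref S f h + condition o ℓ q lam ref S g h := by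
    unfold condition
    split_ifs
    · exact endValue_linear ..
    · exact kirchhoff_linear ..
    · rw [endValue_linear, endValue_linear]
      ring
  have hzero : condition o ℓ q lam ref S 0 h = 0 := by simpa using hlin (-1) 0 0
  exact ⟨fun f g => by simpa using hlin 1 f g, fun c f => by simpa [hzero] using hlin c f 0⟩

theorem charMatrix_mulVec (ref : V → EdgeEnd G) (S : Finset V) (coef : G.edgeSet × Bool → ℂ) :
    (charMatrix o ℓ q lam ref S).mulVec coef = condition o ℓ q lam ref S coef := by
  ext h
  have hsum := (isLinearMap_condition o ℓ q lam ref S h).mk'.pi_apply_eq_sum_univ coef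
  simp only [IsLinearMap.mk'_apply, smul_eq_mul] at hsum
  rw [hsum, Matrix.mulVec, dotProduct]
  refine Finset.sum_congr rfl fun j _ => ?_
  rw [mul_comm, charMatrix, Matrix.of_apply]
  congr 2
  ext i
  simp [Pi.single_apply, eq_comm]

/-- The matrix of the system in which the Kirchhoff condition at `v₀` is replaced by
`α * kirchhoff + β * y = 0`. -/
def robinMatrix (ref : V → EdgeEnd G) (v₀ : V) (α β : ℂ) :
    Matrix (EdgeEnd G) (G.edgeSet × Bool) ℂ :=
  (charMatrix o ℓ q lam ref ∅).updateRow (ref v₀)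
    (α • charMatrix o ℓ q lam ref ∅ (ref v₀) + β • charMatrix o ℓ q lam ref {v₀} (ref v₀))

/-- Membership in `S` is consulted only at reference ends, so the row of `ref v₀` is the only one
that can change. -/
theorem charMatrix_singleton (ref : V → EdgeEnd G) (v₀ : V) :
    charMatrix o ℓ q lam ref {v₀} = (charMatrix o ℓ q lam ref ∅).updateRow (ref v₀)
      (charMatrix o ℓ q lam ref {v₀} (ref v₀)) := by
  ext h j
  by_cases hh : h = ref v₀
  · subst hh
    rw [Matrix.updateRow_self]
  · rw [Matrix.updateRow_ne hh]
    simp only [charMatrix, Matrix.of_apply, condition, Finset.mem_singleton, Finset.notMem_empty,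
      if_false]
    by_cases h1 : h = ref (o.vertex h)
    · have h2 : o.vertex h ≠ v₀ := fun h2 => hh (h2 ▸ h1)
      rw [if_neg h2]
    · rw [if_neg h1, if_neg h1]

theorem det_robinMatrix (ref : V → EdgeEnd G) (v₀ : V) (α β : ℂ) :
    (robinMatrix o ℓ q lam ref v₀ α β).det =
      α * phiN o ℓ q ref lam + β * phiD o ℓ q ref v₀ lam := by
  rw [robinMatrix, Matrix.det_updateRow_add, Matrix.det_updateRow_smul, Matrix.det_updateRow_smul,
    Matrix.updateRow_eq_self, ← charMatrix_singleton]
  rfl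

theorem jost_eq_det (ref : V → EdgeEnd G) (v₀ : V) (a b : ℝ) (z : ℂ) :
    jost o ℓ q ref v₀ a b z = (robinMatrix o ℓ q (z ^ 2) ref v₀ a (Complex.I * z * b)).det := by
  rw [det_robinMatrix, jost]
  ring

variable {o ℓ q lam}

theorem exists_coef_of_det_robinMatrix_eq_zero {ref : V → EdgeEnd G}
    (href : ∀ v, o.vertex (ref v) = v) {v₀ : V} {α β : ℂ}
    (hdet : (robinMatrix o ℓ q lam ref v₀ α β).det = 0) :
    ∃ coef : G.edgeSet × Bool → ℂ, coef ≠ 0 ∧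
      (∀ h, endValue ℓ q lam coef h = endValue ℓ q lam coef (ref (o.vertex h))) ∧
      (∀ v, v ≠ v₀ → kirchhoff o ℓ q lam coef v = 0) ∧
      α * kirchhoff o ℓ q lam coef v₀ + β * endValue ℓ q lam coef (ref v₀) = 0 := by
  obtain ⟨coef, hne, hker⟩ := Matrix.exists_mulVec_eq_zero_iff.2 hdet
  have hrow (h : EdgeEnd G) (hh : h ≠ ref v₀) : condition o ℓ q lam ref ∅ coef h = 0 := by
    have := congrFun hker h
    rw [← charMatrix_mulVec]
    rwa [robinMatrix, Matrix.mulVec, Matrix.updateRow_ne hh] at this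
  refine ⟨coef, hne, fun h => ?_, fun v hv => ?_, ?_⟩
  · by_cases h1 : h = ref (o.vertex h)
    · rw [← h1]
    · have h2 : h ≠ ref v₀ := by
        rintro rfl
        exact h1 (by rw [href])
      have := hrow h h2
      rw [condition, if_neg h1] at this
      exact sub_eq_zero.1 this
  · have h2 : ref v ≠ ref v₀ := fun h => hv (by rw [← href v, h, href])
    simpa [condition, href] using hrow _ h2
  · have := congrFun hker (ref v₀)
    rw [robinMatrix, Matrix.mulVec, Matrix.updateRow_self, add_dotProduct, smul_dotProduct,
      smul_dotProduct] at this
    change α * (charMatrix o ℓ q lam ref ∅).mulVec coef (ref v₀) +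
      β * (charMatrix o ℓ q lam ref {v₀}).mulVec coef (ref v₀) = 0 at this
    simpa [charMatrix_mulVec, condition, href] using this

/-- Grouping the edge ends by vertex, continuity lets the common value factor out of each group and
leaves a Kirchhoff defect, which vanishes away from `v₀`. -/
theorem sum_boundary_eq {ref : V → EdgeEnd G} {v₀ : V} {coef : G.edgeSet × Bool → ℂ}
    (hcont : ∀ h, endValue ℓ q lam coef h = endValue ℓ q lam coef (ref (o.vertex h)))
    (hkir : ∀ v, v ≠ v₀ → kirchhoff o ℓ q lam coef v = 0) :
    ∑ e, (edgeDeriv ℓ q lam coef e ℓ * starRingEnd ℂ (edgeFun ℓ q lam coef e ℓ) -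
        edgeDeriv ℓ q lam coef e 0 * starRingEnd ℂ (edgeFun ℓ q lam coef e 0)) =
      kirchhoff o ℓ q lam coef v₀ * starRingEnd ℂ (endValue ℓ q lam coef (ref v₀)) := by
  have ht (e : G.edgeSet) : edgeFun ℓ q lam coef e ℓ = endValue ℓ q lam coef (ref (o.head e)) :=
    hcont (e, true)
  have hf (e : G.edgeSet) : edgeFun ℓ q lam coef e 0 = endValue ℓ q lam coef (ref (o.tail e)) :=
    hcont (e, false)
  rw [← Finset.sum_eq_single (s := Finset.univ) (f := fun v => kirchhoff o ℓ q lam coef v *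
    starRingEnd ℂ (endValue ℓ q lam coef (ref v))) v₀ (fun v _ hv => by simp [hkir v hv])
    (fun h => absurd (Finset.mem_univ _) h)]
  simp only [kirchhoff, sub_mul, Finset.sum_sub_distrib, Finset.sum_mul]
  congr 1
  · rw [← Finset.sum_fiberwise Finset.univ o.head]
    refine Finset.sum_congr rfl fun v _ => Finset.sum_congr rfl fun e he => ?_
    rw [ht, (Finset.mem_filter.1 he).2]
  · rw [← Finset.sum_fiberwise Finset.univ o.tail]
    refine Finset.sum_congr rfl fun v _ => Finset.sum_congr rfl fun e he => ?_
    rw [hf, (Finset.mem_filter.1 he).2]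

theorem condition_conj (hℓ : 0 < ℓ) (hq : ∀ e, MemLp (q e) 2 (volume.restrict (Set.Ioo 0 ℓ)))
    (ref : V → EdgeEnd G) (S : Finset V) (coef : G.edgeSet × Bool → ℂ) (h : EdgeEnd G) :
    condition o ℓ q (starRingEnd ℂ lam) ref S (fun j => starRingEnd ℂ (coef j)) h =
      starRingEnd ℂ (condition o ℓ q lam ref S coef h) := by
  have hv (h : EdgeEnd G) :
      endValue ℓ q (starRingEnd ℂ lam) (fun j => starRingEnd ℂ (coef j)) h =
        starRingEnd ℂ (endValue ℓ q lam coef h) :=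
    (edge_conj hℓ hq coef h.1 (abscissa_mem_Icc hℓ h.2)).1
  unfold condition
  split_ifs
  · exact hv h
  · simp only [kirchhoff, map_sub, map_sum,
      (edge_conj hℓ hq coef _ (Set.right_mem_Icc.2 hℓ.le)).2,
      (edge_conj hℓ hq coef _ (Set.left_mem_Icc.2 hℓ.le)).2]
  · rw [hv, hv, map_sub]

theorem charFun_conj (hℓ : 0 < ℓ) (hq : ∀ e, MemLp (q e) 2 (volume.restrict (Set.Ioo 0 ℓ)))
    (ref : V → EdgeEnd G) (S : Finset V) :
    charFun o ℓ q ref S (starRingEnd ℂ lam) = starRingEnd ℂ (charFun o ℓ q ref S lam) := by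
  rw [charFun, charFun, RingHom.map_det]
  congr 1
  ext h j
  simp only [charMatrix, Matrix.of_apply, RingHom.mapMatrix_apply, Matrix.map_apply]
  rw [← condition_conj hℓ hq]
  congr 1
  ext i
  by_cases hij : i = j
  · subst hij
    simp
  · simp [Pi.single_eq_of_ne hij]

theorem differentiable_condition (hℓ : 0 < ℓ)
    (hq : ∀ e, MemLp (q e) 2 (volume.restrict (Set.Ioo 0 ℓ)))
    (ref : V → EdgeEnd G) (S : Finset V) (coef : G.edgeSet × Bool → ℂ) (h : EdgeEnd G) :
    Differentiable ℂ fun lam => condition o ℓ q lam ref S coef h := by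
  have hfun (e : G.edgeSet) {x : ℝ} (hx : x ∈ Set.Icc 0 ℓ) :
      Differentiable ℂ (fun lam => edgeFun ℓ q lam coef e x) ∧
        Differentiable ℂ (fun lam => edgeDeriv ℓ q lam coef e x) := by
    have hs := differentiable_solution hℓ.le (hq e) 0 1 hx
    have hc := differentiable_solution hℓ.le (hq e) 1 0 hx
    exact ⟨(hs.1.const_mul _).add (hc.1.const_mul _), (hs.2.const_mul _).add (hc.2.const_mul _)⟩
  have hv (h : EdgeEnd G) : Differentiable ℂ fun lam => endValue ℓ q lam coef h :=
    (hfun h.1 (abscissa_mem_Icc hℓ h.2)).1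
  unfold condition
  split_ifs
  · exact hv h
  · exact (Differentiable.fun_sum fun e _ => (hfun e (Set.right_mem_Icc.2 hℓ.le)).2).sub
      (Differentiable.fun_sum fun e _ => (hfun e (Set.left_mem_Icc.2 hℓ.le)).2)
  · exact (hv h).sub (hv _)

theorem differentiable_charFun (hℓ : 0 < ℓ)
    (hq : ∀ e, MemLp (q e) 2 (volume.restrict (Set.Ioo 0 ℓ)))
    (ref : V → EdgeEnd G) (S : Finset V) : Differentiable ℂ (charFun o ℓ q ref S) := by
  have : charFun o ℓ q ref S = fun lam => ∑ σ : Equiv.Perm (EdgeEnd G),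
      ((Equiv.Perm.sign σ : ℤ) : ℂ) * ∏ i, charMatrix o ℓ q lam ref S (σ i) i :=
    funext fun lam => Matrix.det_apply' _
  rw [this]
  exact Differentiable.fun_sum fun σ _ => (Differentiable.fun_finsetProd fun i _ =>
    differentiable_condition hℓ hq ref S (Pi.single i 1) (σ i)).const_mul _

/-! ### The Jost function and the location of its zeros. -/

theorem differentiable_jost (hℓ : 0 < ℓ)
    (hq : ∀ e, MemLp (q e) 2 (volume.restrict (Set.Ioo 0 ℓ)))
    (ref : V → EdgeEnd G) (v₀ : V) (a b : ℝ) : Differentiable ℂ (jost o ℓ q ref v₀ a b) := by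
  have hsq : Differentiable ℂ fun z : ℂ => z ^ 2 := differentiable_id.pow 2
  have hN : Differentiable ℂ fun z : ℂ => phiN o ℓ q ref (z ^ 2) :=
    (differentiable_charFun hℓ hq ref ∅).comp hsq
  have hD : Differentiable ℂ fun z : ℂ => phiD o ℓ q ref v₀ (z ^ 2) :=
    (differentiable_charFun hℓ hq ref {v₀}).comp hsq
  exact (hN.const_mul _).add ((differentiable_id.const_mul _).mul (hD.const_mul _))

theorem jost_neg_conj (hℓ : 0 < ℓ)
    (hq : ∀ e, MemLp (q e) 2 (volume.restrict (Set.Ioo 0 ℓ)))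
    (ref : V → EdgeEnd G) (v₀ : V) (a b : ℝ) (z : ℂ) :
    jost o ℓ q ref v₀ a b (-(starRingEnd ℂ z)) = starRingEnd ℂ (jost o ℓ q ref v₀ a b z) := by
  have hsq : (-(starRingEnd ℂ z)) ^ 2 = starRingEnd ℂ (z ^ 2) := by rw [neg_sq, map_pow]
  simp only [jost, phiN, phiD, hsq, charFun_conj hℓ hq, map_add, map_mul, Complex.conj_ofReal,
    Complex.conj_I]
  ring

/-- Here `r = |y(v₀)|²`: the Robin condition, multiplied by the conjugate of `y(v₀)`, eliminates the
Kirchhoff defect from the summed Green identity. -/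
theorem exists_jost_zero_energy (hℓ : 0 < ℓ)
    (hq : ∀ e, MemLp (q e) 2 (volume.restrict (Set.Ioo 0 ℓ)))
    {ref : V → EdgeEnd G} (href : ∀ v, o.vertex (ref v) = v) {v₀ : V} {a b : ℝ} {z : ℂ}
    (hz : jost o ℓ q ref v₀ a b z = 0) :
    ∃ (y dy : G.edgeSet → ℝ → ℂ) (r : ℝ), 0 ≤ r ∧
      (∀ e, IsSolution ℓ (q e) (z ^ 2) (y e) (dy e)) ∧ 0 < ∑ e, normSqIntegral ℓ (y e) ∧
      a * (((∑ e, energyForm ℓ (q e) (y e) (dy e) : ℝ) : ℂ) -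
        z ^ 2 * ((∑ e, normSqIntegral ℓ (y e) : ℝ) : ℂ)) = -(Complex.I * z * b * r) := by
  rw [jost_eq_det] at hz
  obtain ⟨coef, hne, hcont, hkir, hrob⟩ := exists_coef_of_det_robinMatrix_eq_zero href hz
  have hsol (e : G.edgeSet) := isSolution_edgeFun (lam := z ^ 2) hℓ hq coef e
  refine ⟨edgeFun ℓ q (z ^ 2) coef, edgeDeriv ℓ q (z ^ 2) coef,
    ‖endValue ℓ q (z ^ 2) coef (ref v₀)‖ ^ 2, by positivity, fun e => (hsol e).1, ?_, ?_⟩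
  · obtain ⟨⟨e, s⟩, hes⟩ := Function.ne_iff.1 hne
    refine Finset.sum_pos' (fun e _ => normSqIntegral_nonneg hℓ.le _) ⟨e, Finset.mem_univ _, ?_⟩
    refine normSqIntegral_pos hℓ (hq e) (hsol e).1 ?_
    rw [(hsol e).2.1, (hsol e).2.2]
    cases s
    · exact .inr hes
    · exact .inl hes
  · have hb := sum_boundary_eq hcont hkir
    simp only [← energyForm_sub_mul_normSqIntegral hℓ.le (hq _) (hsol _).1] at hb
    rw [Finset.sum_sub_distrib, ← Finset.mul_sum] at hb
    have hc := Complex.mul_conj' (endValue ℓ q (z ^ 2) coef (ref v₀))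
    push_cast
    rw [hb, ← hc]
    linear_combination starRingEnd ℂ (endValue ℓ q (z ^ 2) coef (ref v₀)) * hrob

theorem exists_jost_zero_bound (hℓ : 0 < ℓ)
    (hq : ∀ e, MemLp (q e) 2 (volume.restrict (Set.Ioo 0 ℓ)))
    {ref : V → EdgeEnd G} (href : ∀ v, o.vertex (ref v) = v) {v₀ : V} {a b : ℝ} (hab : 0 < a * b) :
    ∃ R : ℝ, 0 < R ∧ ∀ z : ℂ, jost o ℓ q ref v₀ a b z = 0 →
      0 ≤ z.im ∨ (z.re = 0 ∧ -R ≤ z.im ∧ z.im < 0) := by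
  choose C hC0 hC using fun e => exists_energyForm_bound hℓ
    (intervalIntegrable_of_memLp hℓ.le (hq e))
  have hS : 0 ≤ ∑ e, C e := Finset.sum_nonneg fun e _ => hC0 e
  -- With `S = ∑ C e ≥ 0`, adding one makes `R` positive and ensures `R² > S`.
  refine ⟨∑ e, C e + 1, by positivity, fun z hz => ?_⟩
  obtain ⟨y, dy, r, hr, hsol, hpos, hid⟩ := exists_jost_zero_energy hℓ hq href hz
  have ha : 0 < a ^ 2 := by
    have : a ≠ 0 := by
      rintro rfl
      simp at hab
    positivity
  have hlow : 0 ≤ ∑ e, energyForm ℓ (q e) (y e) (dy e) +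
      (∑ e, C e) * ∑ e, normSqIntegral ℓ (y e) := by
    rw [Finset.mul_sum, ← Finset.sum_add_distrib]
    refine Finset.sum_nonneg fun e _ => ?_
    obtain ⟨h0, h1⟩ := (isSolution_iff hℓ.le (hq e) _ _ _).1 (hsol e)
    have h2 := hC e _ _ h0 (h1.continuousOn hℓ.le)
    have h3 : C e * normSqIntegral ℓ (y e) ≤ (∑ e, C e) * normSqIntegral ℓ (y e) :=
      mul_le_mul_of_nonneg_right (Finset.single_le_sum (fun e _ => hC0 e) (Finset.mem_univ e))
        (normSqIntegral_nonneg hℓ.le _)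
    linarith
  generalize ∑ e, energyForm ℓ (q e) (y e) (dy e) = D at hid hlow
  generalize ∑ e, normSqIntegral ℓ (y e) = N at hid hlow hpos
  generalize ∑ e, C e = S at hlow hS ⊢
  have hre := congrArg Complex.re hid
  have him := congrArg Complex.im hid
  simp [pow_two] at hre him
  by_cases hτ : 0 ≤ z.im
  · exact .inl hτ
  push Not at hτ
  refine .inr ?_
  have hx : z.re = 0 := by
    by_contra hx
    -- Multiplication by `a` leaves only `a ^ 2` and `a * b`, whose signs are known; for `Im z < 0`
    -- the second factor is strictly negative.
    have h1 : z.re * (a ^ 2 * (2 * z.im * N) - a * b * r) = 0 := by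
      linear_combination a * him
    have h2 := (mul_eq_zero.1 h1).resolve_left hx
    have h3 : 0 < a ^ 2 * (2 * (-z.im) * N) := by
      have := neg_pos.2 hτ
      positivity
    have h4 : 0 ≤ a * b * r := by positivity
    linarith
  refine ⟨hx, ?_, hτ⟩
  by_contra hlt
  push Not at hlt
  have h1 : a ^ 2 * (D + z.im ^ 2 * N) = z.im * (a * b * r) := by
    rw [hx] at hre
    linear_combination a * hre
  have h2 : z.im * (a * b * r) ≤ 0 := mul_nonpos_of_nonpos_of_nonneg hτ.le (by positivity)
  have h3 : S < z.im ^ 2 := by nlinarith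
  have h4 : 0 < a ^ 2 * (D + z.im ^ 2 * N) := mul_pos ha (by nlinarith)
  linarith

end System

end EquilateralGraph
end

theorem mainTheorem5 {V : Type*} [Fintype V] [DecidableEq V] (G : SimpleGraph V)
    [DecidableRel G.Adj] (hG : G.Connected) (o : EquilateralGraph.Orientation G)
    (ℓ : ℝ) (hℓ : 0 < ℓ) (q : G.edgeSet → ℝ → ℝ)
    (hq : ∀ e, MeasureTheory.MemLp (q e) 2 (MeasureTheory.volume.restrict (Set.Ioo 0 ℓ)))
    (ref : V → EquilateralGraph.EdgeEnd G) (href : ∀ v, o.vertex (ref v) = v)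
    (v₀ : V) (a b : ℝ) (hab : 0 < a * b) :
    Differentiable ℂ (EquilateralGraph.jost o ℓ q ref v₀ a b) ∧
    (∀ z : ℂ, EquilateralGraph.jost o ℓ q ref v₀ a b z = 0 ↔
      EquilateralGraph.jost o ℓ q ref v₀ a b (-(starRingEnd ℂ z)) = 0) ∧
    (∀ z : ℂ, analyticOrderAt (EquilateralGraph.jost o ℓ q ref v₀ a b) (-(starRingEnd ℂ z)) =
      analyticOrderAt (EquilateralGraph.jost o ℓ q ref v₀ a b) z) ∧
    ∃ R : ℝ, 0 < R ∧ ∀ z : ℂ, EquilateralGraph.jost o ℓ q ref v₀ a b z = 0 →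
      0 ≤ z.im ∨ (z.re = 0 ∧ -R ≤ z.im ∧ z.im < 0) :=
  have hsymm := EquilateralGraph.jost_neg_conj (o := o) hℓ hq ref v₀ a b
  have hdiff := EquilateralGraph.differentiable_jost (o := o) hℓ hq ref v₀ a b
  ⟨hdiff, fun z => by rw [hsymm, map_eq_zero],
    EquilateralGraph.analyticOrderAt_neg_conj_eq hdiff hsymm,
    EquilateralGraph.exists_jost_zero_bound hℓ hq href hab⟩
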